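/- Let $n \ge 0$ be an integer and let $S$ be any scheme. Put $\mathbb{P}^n_{\mathbb{Z}} = \operatorname{Proj} \mathbb{Z}[x_0,\dots,x_n]$ with the grading by degree, $\mathbb{P}^n_S = \mathbb{P}^n_{\mathbb{Z}} \times_{\operatorname{Spec}\mathbb{Z}} S$, and let $f : \mathbb{P}^n_S \to S$ be the canonical morphism. Then the connected components of (the underlying space of) $\mathbb{P}^n_S$ are exactly the subsets $f^{-1}(C)$ with $C$ a connected component of $S$. Equivalently, the connected components of $\mathbb{P}^n_S$ are exactly the $\mathbb{P}^n_C$ with $C$ a connected component of $S$ equipped with a closed subscheme structure: for every closed immersion $i : C \to S$ whose image is a connected component of $S$, the induced morphism $\mathbb{P}^n_C \to \mathbb{P}^n_S$ is a closed immersion with image $f^{-1}(i(C))$, and the connected components of $\mathbb{P}^n_S$ are exactly the images of these closed immersions $\mathbb{P}^n_C \to \mathbb{P}^n_S$. -/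

import Mathlib

open CategoryTheory CategoryTheory.Limits AlgebraicGeometry

universe u

noncomputable section

/-- The set of connected components of a topological space `X`, as subsets of `X`
(empty if `X` is empty). -/
def connComps (X : Type u) [TopologicalSpace X] : Set (Set X) :=
  Set.range (connectedComponent : X → Set X)

attribute [local instance] MvPolynomial.gradedAlgebra in
/-- `ℙⁿ_ℤ = Proj ℤ[x₀, …, xₙ]` for the grading by degree. The ring `ULift ℤ` is `ℤ` in the
universe `u`. -/
def ProjSpaceInt (n : ℕ) : Scheme.{u} :=
  Proj (MvPolynomial.homogeneousSubmodule (Fin (n + 1)) (ULift.{u} ℤ))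

/-- `ℙⁿ_S = ℙⁿ_ℤ ×_{Spec ℤ} S`. The two maps to `Spec ℤ` are the unique ones, as `Spec ℤ` is a
terminal scheme. -/
def ProjSpace (n : ℕ) (S : Scheme.{u}) : Scheme.{u} :=
  pullback (specULiftZIsTerminal.{u}.from (ProjSpaceInt.{u} n)) (specULiftZIsTerminal.{u}.from S)

/-- The canonical morphism `ℙⁿ_S ⟶ S`. -/
def ProjSpace.toBase (n : ℕ) (S : Scheme.{u}) : ProjSpace n S ⟶ S :=
  pullback.snd _ _

/-- The morphism `ℙⁿ_C ⟶ ℙⁿ_S` induced by `i : C ⟶ S`, that is, `id ×_{Spec ℤ} i`. -/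
def ProjSpace.map (n : ℕ) {C S : Scheme.{u}} (i : C ⟶ S) : ProjSpace n C ⟶ ProjSpace n S :=
  pullback.lift (pullback.fst _ _) (pullback.snd _ _ ≫ i)
    (specULiftZIsTerminal.{u}.hom_ext _ _)

end

/-! The morphism `f : ℙⁿ_S ⟶ S` is universally closed and surjective, hence a topological quotient
map, and its fibres are connected; for such a map, taking preimages is a bijection on connected
components. The fibres are even geometrically connected: over a field, projective space is covered
by the images of the maps `(x₀, …, xₙ) ↦ (x₀ : … : 1 : … : xₙ)` from affine space, each of which is
irreducible, and all of these images contain the point `(1 : … : 1)`. -/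

section Topology

open Topology

lemma connComps_eq_of_isCoinducing {X Y : Type u} [TopologicalSpace X] [TopologicalSpace Y]
    {f : X → Y} (hf : IsCoinducing f) (hfib : ∀ y, IsConnected (f ⁻¹' {y})) :
    connComps X = {Z | ∃ C ∈ connComps Y, Z = f ⁻¹' C} := by
  ext Z
  constructor
  · rintro ⟨x, rfl⟩
    exact ⟨_, ⟨f x, rfl⟩, (hf.preimage_connectedComponent hfib x).symm⟩
  · rintro ⟨_, ⟨y, rfl⟩, rfl⟩
    obtain ⟨x, rfl⟩ := (hfib y).nonempty
    exact ⟨x, (hf.preimage_connectedComponent hfib x).symm⟩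

lemma isClosed_of_mem_connComps {X : Type u} [TopologicalSpace X] {C : Set X}
    (hC : C ∈ connComps X) : IsClosed C := by
  obtain ⟨x, rfl⟩ := hC
  exact isClosed_connectedComponent

end Topology

section GeometricallyConnected

variable {X Y S : Scheme.{u}}

lemma connComps_eq_of_geometricallyConnected (f : X ⟶ S) [GeometricallyConnected f]
    [UniversallyClosed f] : connComps X = {Z | ∃ C ∈ connComps S, Z = f ⁻¹' C} :=
  connComps_eq_of_isCoinducing
    (f.isClosedMap.isQuotientMap f.continuous f.surjective).isCoinducing
    f.isConnected_preimage_singleton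

lemma geometricallyConnected_of_geometricallyIrreducible (f : X ⟶ S)
    [GeometricallyIrreducible f] : GeometricallyConnected f :=
  ⟨fun _ _ _ _ _ _ h ↦
    have := GeometricallyIrreducible.geometrically_irreducibleSpace _ _ _ h
    inferInstance⟩

lemma isPreconnected_preimage_range_of_geometricallyConnected_comp (g : Y ⟶ X) (f : X ⟶ S)
    [GeometricallyConnected (g ≫ f)] {K : Type u} [Field K] (y : Spec (.of K) ⟶ S) :
    _root_.IsPreconnected (pullback.fst f y ⁻¹' Set.range g) := by
  have : ConnectedSpace ↥(pullback (g ≫ f) y) :=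
    pullback_of_geometrically GeometricallyConnected.geometrically_connectedSpace K y
  have hrange : Set.range (pullback.map (g ≫ f) y f y g (𝟙 _) (𝟙 _) (by simp) (by simp)) =
      pullback.fst f y ⁻¹' Set.range g := by
    rw [Scheme.Pullback.range_map, range_eq_univ (𝟙 (Spec (.of K))),
      Set.preimage_univ, Set.inter_univ]
  exact hrange ▸ isPreconnected_range (Scheme.Hom.continuous _)

lemma geometricallyConnected_of_iUnion_range_eq_univ (f : X ⟶ S) {ι : Type*}
    {U : ι → Scheme.{u}} (g : ∀ i, U i ⟶ X) [∀ i, GeometricallyConnected (g i ≫ f)]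
    (hcover : ⋃ i, Set.range (g i) = Set.univ)
    (hinter : Set.SurjOn f (⋂ i, Set.range (g i)) Set.univ) : GeometricallyConnected f := by
  refine ⟨geometrically_iff_of_isClosedUnderIsomorphisms.mpr fun K _ y ↦ ?_⟩
  obtain ⟨t⟩ := (inferInstance : Nonempty (Spec (.of K)))
  obtain ⟨x, hx, hxt⟩ := hinter (Set.mem_univ (y t))
  obtain ⟨z, rfl, -⟩ := Scheme.Pullback.exists_preimage_pullback x t hxt
  have hpre := isPreconnected_iUnion (s := fun i ↦ pullback.fst f y ⁻¹' Set.range (g i))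
    ⟨z, Set.mem_iInter.mpr fun i ↦ Set.mem_iInter.mp hx i⟩
    fun i ↦ isPreconnected_preimage_range_of_geometricallyConnected_comp (g i) f y
  rw [← Set.preimage_iUnion, hcover, Set.preimage_univ] at hpre
  exact { isPreconnected_univ := hpre, toNonempty := ⟨z⟩ }

end GeometricallyConnected

section Dehomogenization

open MvPolynomial HomogeneousLocalization

attribute [local instance] MvPolynomial.gradedAlgebra

lemma eval₂_mul_left_of_isHomogeneous {σ R A : Type*} [CommSemiring R] [CommSemiring A]
    {p : MvPolynomial σ R} {m : ℕ} (hp : p.IsHomogeneous m) (g : R →+* A) (c : A) (x : σ → A) :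
    eval₂ g (fun j ↦ c * x j) p = c ^ m * eval₂ g x p := by
  rw [eval₂_eq, eval₂_eq, Finset.mul_sum]
  refine Finset.sum_congr rfl fun d hd ↦ ?_
  have hdeg : ∑ j ∈ d.support, d j = m := (hp.degree_eq_sum_deg_support hd).symm
  simp only [mul_pow, Finset.prod_mul_distrib, Finset.prod_pow_eq_pow_sum, hdeg]
  ring

variable {σ R : Type*} [CommRing R]

variable (σ R) in
lemma algebraMap_homogeneousSubmodule_zero_surjective :
    Function.Surjective (algebraMap R (homogeneousSubmodule σ R 0)) := by
  rintro ⟨p, hp⟩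
  rw [homogeneousSubmodule_zero, Submodule.mem_one] at hp
  obtain ⟨r, rfl⟩ := hp
  exact ⟨r, rfl⟩

lemma X_mem_homogeneousSubmodule (i : σ) : X i ∈ homogeneousSubmodule σ R 1 :=
  isHomogeneous_X R i

variable (R) in
/-- The fraction `xⱼ / xᵢ` in the degree zero part of `R[x]_{xᵢ}`. -/
noncomputable def coordRatio (i j : σ) : Away (homogeneousSubmodule σ R) (X i) :=
  Away.mk _ (X_mem_homogeneousSubmodule i) 1 (X j) (by simpa using isHomogeneous_X R j)

lemma algebraMap_mul_val_coordRatio (i j : σ) :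
    algebraMap (MvPolynomial σ R) (Localization.Away (X i : MvPolynomial σ R)) (X i) *
      (coordRatio R i j).val = algebraMap (MvPolynomial σ R) (Localization.Away (X i)) (X j) := by
  rw [coordRatio, Away.val_mk, Localization.mk_eq_mk']
  simpa only [pow_one] using
    IsLocalization.mk'_spec' (Localization.Away (X i : MvPolynomial σ R)) (X j)
      (⟨X i ^ 1, 1, rfl⟩ : Submonoid.powers (X i))

lemma coordRatio_self (i : σ) : coordRatio R i i = 1 := by
  have hunit := IsLocalization.Away.algebraMap_isUnit
    (S := Localization.Away (X i : MvPolynomial σ R)) (X i : MvPolynomial σ R)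
  apply val_injective
  rw [val_one, ← hunit.mul_right_inj, algebraMap_mul_val_coordRatio, mul_one]

variable (R) in
/-- The ring map `R[x] → (R[x]_{xᵢ})₀` sending `xⱼ` to `xⱼ / xᵢ`. -/
noncomputable def evalCoordRatio (i : σ) :
    MvPolynomial σ R →+* Away (homogeneousSubmodule σ R) (X i) :=
  eval₂Hom ((fromZeroRingHom (homogeneousSubmodule σ R) _).comp (algebraMap R _)) (coordRatio R i)

lemma evalCoordRatio_of_isHomogeneous (i : σ) {p : MvPolynomial σ R} {m : ℕ}
    (hp : p.IsHomogeneous m) :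
    evalCoordRatio R i p =
      Away.mk _ (X_mem_homogeneousSubmodule i) m p (by simpa using hp) := by
  let B := Localization.Away (X i : MvPolynomial σ R)
  have hcoeff : (algebraMap (Away (homogeneousSubmodule σ R) (X i)) B).comp
      ((fromZeroRingHom (homogeneousSubmodule σ R) _).comp (algebraMap R _)) =
      (algebraMap (MvPolynomial σ R) B).comp C := rfl
  have hscale : algebraMap (MvPolynomial σ R) B (X i) ^ m * (evalCoordRatio R i p).val =
      algebraMap (MvPolynomial σ R) B p := by
    calc algebraMap (MvPolynomial σ R) B (X i) ^ m * (evalCoordRatio R i p).val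
      _ = algebraMap (MvPolynomial σ R) B (X i) ^ m *
            eval₂ ((algebraMap (MvPolynomial σ R) B).comp C)
              (fun j ↦ (coordRatio R i j).val) p := by
          rw [← HomogeneousLocalization.algebraMap_apply, evalCoordRatio, coe_eval₂Hom, hom_eval₂,
            hcoeff]
          rfl
      _ = eval₂ ((algebraMap (MvPolynomial σ R) B).comp C)
            (fun j ↦ algebraMap (MvPolynomial σ R) B (X j)) p := by
          rw [← eval₂_mul_left_of_isHomogeneous hp]
          simp only [B, algebraMap_mul_val_coordRatio]
      _ = algebraMap (MvPolynomial σ R) B p := by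
          conv_rhs => rw [← eval₂_eta p, hom_eval₂]
  apply val_injective
  rw [Away.val_mk, Localization.mk_eq_mk', IsLocalization.eq_mk'_iff_mul_eq, mul_comm, map_pow]
  exact hscale

variable [DecidableEq σ]

variable (R) in
/-- Dehomogenization, the ring map `(R[x]_{xᵢ})₀ → R[x]` setting `xᵢ = 1`. The polynomial ring keeps
the variable `xᵢ`, so this is a split injection rather than an isomorphism. -/
noncomputable def dehomogenize (i : σ) :
    Away (homogeneousSubmodule σ R) (X i) →+* MvPolynomial σ R :=
  (Localization.awayLift (eval₂Hom C (Function.update X i 1)) (X i) (by simp)).comp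
    (algebraMap _ (Localization.Away (X i)))

lemma dehomogenize_mk (i : σ) (m : ℕ) (p : MvPolynomial σ R)
    (hp : p ∈ homogeneousSubmodule σ R (m • 1)) :
    dehomogenize R i (Away.mk _ (X_mem_homogeneousSubmodule i) m p hp) =
      eval₂ C (Function.update X i 1) p := by
  rw [dehomogenize, RingHom.comp_apply, HomogeneousLocalization.algebraMap_apply, Away.val_mk,
    Localization.awayLift_mk (v := 1) (hv := by simp), one_pow, mul_one, coe_eval₂Hom]

lemma dehomogenize_comp_fromZeroRingHom (i : σ) :
    (dehomogenize R i).comp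
      ((fromZeroRingHom (homogeneousSubmodule σ R) _).comp (algebraMap R _)) = C := by
  ext1 r
  have h := dehomogenize_mk i 0 (C r) (by simp)
  rw [eval₂_C] at h
  rw [← h]
  refine congr_arg (dehomogenize R i) (val_injective _ ?_)
  simp only [RingHom.coe_comp, Function.comp_apply, Away.val_mk, pow_zero]
  rfl

lemma evalCoordRatio_comp_dehomogenize (i : σ) :
    (evalCoordRatio R i).comp (dehomogenize R i) = RingHom.id _ := by
  ext1 a
  obtain ⟨m, p, hp, rfl⟩ := Away.mk_surjective _ (X_mem_homogeneousSubmodule i) a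
  have hupdate : evalCoordRatio R i ∘ Function.update X i 1 = coordRatio R i := by
    funext j
    obtain rfl | hj := eq_or_ne j i
    · simp [coordRatio_self]
    · simp [hj, evalCoordRatio]
  calc evalCoordRatio R i (dehomogenize R i (Away.mk _ _ m p hp))
    _ = eval₂ ((evalCoordRatio R i).comp C) (evalCoordRatio R i ∘ Function.update X i 1) p := by
        rw [dehomogenize_mk, hom_eval₂]
        rfl
    _ = evalCoordRatio R i p := by
        rw [hupdate, evalCoordRatio, eval₂Hom_comp_C, coe_eval₂Hom]
    _ = Away.mk _ _ m p hp := evalCoordRatio_of_isHomogeneous i (by simpa using hp)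

end Dehomogenization

section Proj

variable {R A : Type u} [CommRing R] [CommRing A] [Algebra R A]
  (𝒜 : ℕ → Submodule R A) [GradedAlgebra 𝒜]

/-- The structure morphism `Proj 𝒜 ⟶ Spec R` for an `ℕ`-graded `R`-algebra `𝒜`. -/
noncomputable def projToSpec : Proj 𝒜 ⟶ Spec (.of R) :=
  Proj.toSpecZero 𝒜 ≫ Spec.map (CommRingCat.ofHom (algebraMap R (𝒜 0)))

lemma awayι_projToSpec {f : A} {m : ℕ} (hf : f ∈ 𝒜 m) (hm : 0 < m) :
    Proj.awayι 𝒜 f hf hm ≫ projToSpec 𝒜 = Spec.map (CommRingCat.ofHom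
      ((HomogeneousLocalization.fromZeroRingHom 𝒜 _).comp (algebraMap R (𝒜 0)))) := by
  rw [projToSpec, Proj.awayι_toSpecZero_assoc, CommRingCat.ofHom_comp, Spec.map_comp]

lemma universallyClosed_projToSpec [Algebra.FiniteType R A] [Algebra.IsIntegral R (𝒜 0)] :
    UniversallyClosed (projToSpec 𝒜) := by
  have := IsScalarTower.of_algebraMap_eq (R := R) (S := 𝒜 0) (A := A) fun _ ↦ rfl
  have : Algebra.FiniteType (𝒜 0) A := .of_restrictScalars_finiteType R (𝒜 0) A
  have : IsIntegralHom (Spec.map (CommRingCat.ofHom (algebraMap R (𝒜 0)))) :=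
    IsIntegralHom.SpecMap_iff.mpr (algebraMap_isIntegral_iff.mpr inferInstance)
  unfold projToSpec
  infer_instance

end Proj

section AffineChart

open MvPolynomial

universe v

attribute [local instance] MvPolynomial.gradedAlgebra

instance geometricallyIrreducible_specMap_C (σ : Type v) (R : Type (max u v)) [CommRing R] :
    GeometricallyIrreducible (Spec.map (CommRingCat.ofHom (C : R →+* MvPolynomial σ R))) := by
  -- `𝔸(n; S)` requires `n` and `S` to live in the same universe.
  let e := (renameEquiv R (Equiv.ulift.{u} : ULift σ ≃ σ)).toRingEquiv.toCommRingCatIso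
  have he : CommRingCat.ofHom C ≫ e.hom = CommRingCat.ofHom (C : R →+* MvPolynomial σ R) := by
    ext r
    simp [e]
  rw [← he, Spec.map_comp, ← AffineSpace.SpecIso_inv_over (.of R)]
  infer_instance

variable {σ : Type v} {R : Type (max u v)} [CommRing R]

variable (σ R) in
lemma universallyClosed_projToSpec_homogeneousSubmodule [Finite σ] :
    UniversallyClosed (projToSpec (homogeneousSubmodule σ R)) := by
  have : Algebra.IsIntegral R (homogeneousSubmodule σ R 0) :=
    algebraMap_isIntegral_iff.mp <| RingHom.isIntegral_of_surjective _ <|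
      algebraMap_homogeneousSubmodule_zero_surjective σ R
  exact universallyClosed_projToSpec _

variable (σ R) in
lemma iSup_basicOpen_X_eq_top :
    ⨆ i, Proj.basicOpen (homogeneousSubmodule σ R) (X i) = ⊤ := by
  refine Proj.iSup_basicOpen_eq_top' _ X (fun i ↦ ⟨1, X_mem_homogeneousSubmodule i⟩)
    (eq_top_iff.mpr ?_)
  rintro p -
  induction p using MvPolynomial.induction_on with
  | C r => exact Subalgebra.algebraMap_mem _ (algebraMap R (homogeneousSubmodule σ R 0) r)
  | add p q hp hq => exact add_mem hp hq
  | mul_X p i hp => exact mul_mem hp (Algebra.subset_adjoin ⟨i, rfl⟩)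

section DecidableEq

variable [DecidableEq σ]

variable (R) in
/-- The morphism `(xⱼ)ⱼ ↦ (xⱼ)ⱼ` with `xᵢ` replaced by `1`, from the affine space with coordinates
indexed by `σ` to the projective space with homogeneous coordinates indexed by `σ`. The superfluous
coordinate `xᵢ` is kept, so this surjects onto the standard chart `D₊(xᵢ)` but is not injective. -/
noncomputable def affineChart (i : σ) :
    Spec (.of (MvPolynomial σ R)) ⟶ Proj (homogeneousSubmodule σ R) :=
  Spec.map (CommRingCat.ofHom (dehomogenize R i)) ≫
    Proj.awayι _ _ (X_mem_homogeneousSubmodule i) one_pos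

lemma affineChart_projToSpec (i : σ) :
    affineChart R i ≫ projToSpec (homogeneousSubmodule σ R) =
      Spec.map (CommRingCat.ofHom C) := by
  rw [affineChart, Category.assoc, awayι_projToSpec, ← Spec.map_comp, ← CommRingCat.ofHom_comp,
    dehomogenize_comp_fromZeroRingHom]

lemma range_affineChart (i : σ) :
    Set.range (affineChart R i) = Proj.basicOpen (homogeneousSubmodule σ R) (X i) := by
  have hsection : Spec.map (CommRingCat.ofHom (evalCoordRatio R i)) ≫
      Spec.map (CommRingCat.ofHom (dehomogenize R i)) = 𝟙 _ := by
    rw [← Spec.map_comp, ← CommRingCat.ofHom_comp, evalCoordRatio_comp_dehomogenize,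
      CommRingCat.ofHom_id, Spec.map_id]
  have : Surjective (Spec.map (CommRingCat.ofHom (dehomogenize R i))) :=
    have : Surjective (Spec.map (CommRingCat.ofHom (evalCoordRatio R i)) ≫
      Spec.map (CommRingCat.ofHom (dehomogenize R i))) := hsection ▸ inferInstance
    .of_comp (Spec.map (CommRingCat.ofHom (evalCoordRatio R i))) _
  rw [← Proj.opensRange_awayι _ _ (X_mem_homogeneousSubmodule i) one_pos]
  exact range_eq_range_of_surjective _ _ (Spec.map (CommRingCat.ofHom (dehomogenize R i))) rfl

lemma affineChart_preimage_basicOpen (i j : σ) :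
    affineChart R i ⁻¹ᵁ Proj.basicOpen (homogeneousSubmodule σ R) (X j) =
      PrimeSpectrum.basicOpen (Function.update X i 1 j) := by
  rw [affineChart, Scheme.Hom.comp_preimage,
    Proj.awayι_preimage_basicOpen _ _ _ (X_mem_homogeneousSubmodule j) one_pos]
  refine TopologicalSpace.Opens.ext (congr_arg (fun p ↦ SetLike.coe (PrimeSpectrum.basicOpen p)) ?_)
  rw [CommRingCat.hom_ofHom, HomogeneousLocalization.Away.isLocalizationElem, dehomogenize_mk,
    pow_one, eval₂_X]

lemma surjOn_projToSpec_iInter_range_affineChart [Nonempty σ] :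
    Set.SurjOn (projToSpec (homogeneousSubmodule σ R)) (⋂ i, Set.range (affineChart R i))
      Set.univ := by
  intro s _
  obtain ⟨i⟩ := ‹Nonempty σ›
  let ones := Spec.map (CommRingCat.ofHom (eval (1 : σ → R)))
  refine ⟨affineChart R i (ones s), Set.mem_iInter.mpr fun j ↦ ?_, ?_⟩
  · rw [range_affineChart]
    change ones s ∈ affineChart R i ⁻¹ᵁ Proj.basicOpen (homogeneousSubmodule σ R) (X j)
    rw [affineChart_preimage_basicOpen]
    change eval (1 : σ → R) (Function.update X i 1 j) ∉ s.asIdeal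
    have h : eval (1 : σ → R) (Function.update X i 1 j) = 1 := by
      obtain rfl | hj := eq_or_ne j i <;> simp [*]
    exact h ▸ s.isPrime.one_notMem
  · rw [← Scheme.Hom.comp_apply, affineChart_projToSpec, ← Scheme.Hom.comp_apply, ← Spec.map_comp,
      ← CommRingCat.ofHom_comp]
    have h : (eval (1 : σ → R)).comp C = RingHom.id R := by ext1; simp
    rw [h, CommRingCat.ofHom_id, Spec.map_id]
    rfl

end DecidableEq

variable (σ R) in
lemma geometricallyConnected_projToSpec_homogeneousSubmodule [Nonempty σ] :
    GeometricallyConnected (projToSpec (homogeneousSubmodule σ R)) := by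
  classical
  have (i : σ) :
      GeometricallyConnected (affineChart R i ≫ projToSpec (homogeneousSubmodule σ R)) := by
    rw [affineChart_projToSpec]
    exact geometricallyConnected_of_geometricallyIrreducible _
  refine geometricallyConnected_of_iUnion_range_eq_univ _ (affineChart.{u, v} R) ?_
    surjOn_projToSpec_iInter_range_affineChart
  simp_rw [range_affineChart]
  simpa using! congr_arg SetLike.coe (iSup_basicOpen_X_eq_top.{u, v} σ R)

end AffineChart

namespace ProjSpace

attribute [local instance] MvPolynomial.gradedAlgebra

lemma terminal_from_projSpaceInt (n : ℕ) :
    specULiftZIsTerminal.from (ProjSpaceInt.{u} n) =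
      projToSpec (MvPolynomial.homogeneousSubmodule (Fin (n + 1)) (ULift.{u} ℤ)) :=
  specULiftZIsTerminal.hom_ext _ _

instance geometricallyConnected_toBase (n : ℕ) (S : Scheme.{u}) :
    GeometricallyConnected (toBase n S) :=
  MorphismProperty.of_isPullback (IsPullback.of_hasPullback _ _) <|
    terminal_from_projSpaceInt n ▸ geometricallyConnected_projToSpec_homogeneousSubmodule _ _

instance universallyClosed_toBase (n : ℕ) (S : Scheme.{u}) :
    UniversallyClosed (toBase n S) :=
  MorphismProperty.of_isPullback (IsPullback.of_hasPullback _ _) <|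
    terminal_from_projSpaceInt n ▸ universallyClosed_projToSpec_homogeneousSubmodule _ _

lemma isPullback_map (n : ℕ) {C S : Scheme.{u}} (i : C ⟶ S) :
    IsPullback (map n i) (toBase n C) (toBase n S) i := by
  refine .of_right ?_ (pullback.lift_snd _ _ _) (IsPullback.of_hasPullback _ _)
  have hfst : map n i ≫ pullback.fst _ _ = pullback.fst _ _ := pullback.lift_fst _ _ _
  rw [hfst, specULiftZIsTerminal.hom_ext (i ≫ specULiftZIsTerminal.from S)
    (specULiftZIsTerminal.from C)]
  exact IsPullback.of_hasPullback _ _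

lemma range_map (n : ℕ) {C S : Scheme.{u}} (i : C ⟶ S) :
    Set.range (map n i) = toBase n S ⁻¹' Set.range i := by
  rw [← (isPullback_map n i).isoPullback_hom_fst, ← Scheme.Pullback.range_fst]
  exact range_eq_range_of_surjective _ _ (isPullback_map n i).isoPullback.hom rfl

end ProjSpace

lemma exists_isClosedImmersion_range_eq {S : Scheme.{u}} {Z : Set S} (hZ : IsClosed Z) :
    ∃ (C : Scheme.{u}) (i : C ⟶ S), IsClosedImmersion i ∧ Set.range i = Z :=
  ⟨_, (Scheme.IdealSheafData.vanishingIdeal ⟨Z, hZ⟩).subschemeι, inferInstance, by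
    simp [Scheme.IdealSheafData.range_subschemeι]⟩

theorem theorem4p6 (n : ℕ) (S : Scheme.{u}) :
    -- the connected components of `ℙⁿ_S` are exactly the sets `f⁻¹(C)`
    connComps (ProjSpace n S) =
      {Z | ∃ C ∈ connComps S, Z = (ProjSpace.toBase n S) ⁻¹' C} ∧
    -- for every closed subscheme structure on a connected component `C` of `S`, `ℙⁿ_C` is a
    -- closed subscheme of `ℙⁿ_S` with underlying set `f⁻¹(C)`
    (∀ (C : Scheme.{u}) (i : C ⟶ S), IsClosedImmersion i → Set.range i ∈ connComps S →
      IsClosedImmersion (ProjSpace.map n i) ∧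
        Set.range (ProjSpace.map n i) = (ProjSpace.toBase n S) ⁻¹' (Set.range i)) ∧
    -- the connected components of `ℙⁿ_S` are exactly the `ℙⁿ_C`
    connComps (ProjSpace n S) =
      {Z | ∃ (C : Scheme.{u}) (i : C ⟶ S), IsClosedImmersion i ∧ Set.range i ∈ connComps S ∧
        Z = Set.range (ProjSpace.map n i)} := by
  have hcomp := connComps_eq_of_geometricallyConnected (ProjSpace.toBase n S)
  refine ⟨hcomp, fun C i hi _ ↦
    ⟨MorphismProperty.of_isPullback (ProjSpace.isPullback_map n i).flip hi,
      ProjSpace.range_map n i⟩, ?_⟩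
  rw [hcomp]
  ext Z
  constructor
  · rintro ⟨C, hC, rfl⟩
    obtain ⟨C, i, hi, rfl⟩ := exists_isClosedImmersion_range_eq (isClosed_of_mem_connComps hC)
    exact ⟨C, i, hi, hC, (ProjSpace.range_map n i).symm⟩
  · rintro ⟨C, i, -, hC, rfl⟩
    exact ⟨_, hC, ProjSpace.range_map n i⟩
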